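/- Let $d \ge 1$ and let $\xi_1, \xi_2, \dots$ be independent random variables, each uniformly distributed on the $2d$ elements $e_1^{\pm 1}, \dots, e_d^{\pm 1}$ of the free group with generators $e_1, \dots, e_d$. Let $L_n$ be the length of the reduced word of the product $\xi_1 \xi_2 \cdots \xi_n$. Put $$h_L(\theta) = \begin{cases} \dfrac{2d-1}{2d} e^{\theta} + \dfrac{1}{2d} e^{-\theta}, & \theta \ge -\tfrac12 \log(2d-1), \\[2mm] \dfrac{\sqrt{2d-1}}{d}, & \theta < -\tfrac12 \log(2d-1), \end{cases} \qquad I_L(x) = \sup_{\theta \in \mathbb{R}} \bigl[\theta x - \log h_L(\theta)\bigr] \quad (x \in \mathbb{R}).$$ Then the laws of $L_n/n$, $n \ge 1$, satisfy the large deviations principle on $\mathbb{R}$ with rate function $I_L$; that is, $I_L : \mathbb{R} \to [0, \infty]$ is lower semicontinuous, and for every Borel set $\Gamma \subseteq \mathbb{R}$, $$-\inf_{x \in \operatorname{int} \Gamma} I_L(x) \le \liminf_{n \to \infty} \frac1n \log \mathbb{P}\Bigl(\frac{L_n}{n} \in \Gamma\Bigr) \le \limsup_{n \to \infty} \frac1n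 \log \mathbb{P}\Bigl(\frac{L_n}{n} \in \Gamma\Bigr) \le -\inf_{x \in \overline{\Gamma}} I_L(x),$$ where $\log 0 = -\infty$ and $\inf \emptyset = +\infty$. -/

import Mathlib

open MeasureTheory ProbabilityTheory Filter Topology

noncomputable section

/-- A rate function on a topological space: a lower semicontinuous function with values in
`[0, ∞]`. -/
structure IsRateFunction {X : Type*} [TopologicalSpace X] (I : X → EReal) : Prop where
  nonneg : ∀ x, 0 ≤ I x
  lowerSemicontinuous : LowerSemicontinuous I

/-- The sequence of measures `ν 1, ν 2, …` satisfies the large deviations principle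
(with speed `n`) with rate function `I`. The conventions are `log 0 = -∞` and `inf ∅ = +∞`;
the value `ν 0` plays no role. -/
structure SatisfiesLDP {X : Type*} [TopologicalSpace X] [MeasurableSpace X]
    (ν : ℕ → Measure X) (I : X → EReal) : Prop where
  isRateFunction : IsRateFunction I
  lower_bound : ∀ Γ : Set X, MeasurableSet Γ →
    -(⨅ x ∈ interior Γ, I x) ≤
      liminf (fun n : ℕ => ENNReal.log (ν n Γ) / (n : EReal)) atTop
  upper_bound : ∀ Γ : Set X, MeasurableSet Γ →
    limsup (fun n : ℕ => ENNReal.log (ν n Γ) / (n : EReal)) atTop ≤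
      -(⨅ x ∈ closure Γ, I x)

/-- The element of the free group on `d` generators reached after `n` steps, starting at the
empty word, when the successive letters `s 0, s 1, …` are multiplied on the right.
The letter `(i, true)` is the generator `e_i` and `(i, false)` is its inverse. -/
def freeGroupWalk {d : ℕ} (s : ℕ → Fin d × Bool) : ℕ → FreeGroup (Fin d)
  | 0 => 1
  | n + 1 => freeGroupWalk s n * FreeGroup.mk [s n]

/-- The length of the reduced word after `n` steps. -/
def reducedLength {d : ℕ} (s : ℕ → Fin d × Bool) (n : ℕ) : ℕ :=
  (freeGroupWalk s n).norm

/-- The function `h_L`. -/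
def hL (d : ℕ) (θ : ℝ) : ℝ :=
  if -(1 / 2) * Real.log (2 * (d : ℝ) - 1) ≤ θ then
    (2 * (d : ℝ) - 1) / (2 * (d : ℝ)) * Real.exp θ + 1 / (2 * (d : ℝ)) * Real.exp (-θ)
  else
    Real.sqrt (2 * (d : ℝ) - 1) / (d : ℝ)

/-- The Legendre transform of a real function, with values in the extended reals. -/
def legendreTransform (f : ℝ → ℝ) (x : ℝ) : EReal :=
  ⨆ θ : ℝ, ((θ * x - f θ : ℝ) : EReal)

end

/-! Only one letter shortens a nonempty reduced word, so `L_n` is a Markov chain on `ℕ` with up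
probability p = (2d-1)/(2d) and down probability q = 1/(2d), except that 0 always leads to 1
(`lintegral_reducedLength_succ`).

Upper bound: with u = e^θ and r = q/(pu), both u^k and r^k are eigenfunctions away from 0 with
eigenvalue pu + q/u. For a suitable b ≥ 0 the sum u^k + b r^k is superharmonic at 0 too, so E e^{θ
L_n} ≤ C h_L(θ)^n; below the threshold, monotonicity in θ replaces this. Chebyshev's inequality and
compactness of [0, 1] then give the bound for every set, without convexity or differentiability of
log h_L.

Lower bound: each nonnegative path with b down steps and n - b up steps has weight at least p^(n-b)
q^b, and the ballot numbers counting these paths are binomial coefficients up to a polynomial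
factor. Hence P(L_n = n - 2b) is at least the exponential of n times `speedEntropy`, up to a
polynomial factor. Since -`speedEntropy` ≤ I_L on [0, 1] and I_L = ∞ elsewhere, this suffices. -/

noncomputable section

/-! ### The word length as a Markov chain -/

/-- Multiplying by a letter on the right, seen on the reduced word of the inverse. -/
lemma norm_mul_mk_singleton {α : Type*} [DecidableEq α] (g : FreeGroup α) (a : α × Bool) :
    (g * FreeGroup.mk [a]).norm = (List.casesOn (motive := fun _ => List (α × Bool)) g⁻¹.toWord
      [(a.1, !a.2)] fun hd tl =>
        if a.1 = hd.1 ∧ (!a.2) = !hd.2 then tl else (a.1, !a.2) :: hd :: tl).length := by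
  have h : (g * FreeGroup.mk [a])⁻¹ = FreeGroup.mk ((a.1, !a.2) :: g⁻¹.toWord) := by
    rw [mul_inv_rev, FreeGroup.inv_mk, ← List.singleton_append (x := (a.1, !a.2)),
      ← FreeGroup.mul_mk, FreeGroup.mk_toWord]
    rfl
  rw [← FreeGroup.norm_inv_eq, h, FreeGroup.norm, FreeGroup.toWord_mk, FreeGroup.reduce.cons,
    FreeGroup.reduce_toWord]

/-- From the empty word every letter leads to a word of length one. -/
lemma sum_norm_mul_mk_of_norm_eq_zero {α M : Type*} [DecidableEq α] [Fintype α] [AddCommMonoid M]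
    (f : ℕ → M) {g : FreeGroup α} (hg : g.norm = 0) :
    ∑ a : α × Bool, f (g * FreeGroup.mk [a]).norm = (2 * Fintype.card α) • f 1 := by
  obtain rfl := FreeGroup.norm_eq_zero.1 hg
  simp only [norm_mul_mk_singleton]
  simp [mul_comm 2]

/-- From a nonempty reduced word exactly one letter shortens the word, all others lengthen it. -/
lemma sum_norm_mul_mk_of_norm_eq_succ {α M : Type*} [DecidableEq α] [Fintype α] [AddCommMonoid M]
    (f : ℕ → M) {g : FreeGroup α} {k : ℕ} (hg : g.norm = k + 1) :
    ∑ a : α × Bool, f (g * FreeGroup.mk [a]).norm =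
      (2 * Fintype.card α - 1) • f (k + 2) + f k := by
  have hl : g⁻¹.toWord.length = k + 1 := by rw [← hg, ← FreeGroup.norm_inv_eq]; rfl
  simp only [norm_mul_mk_singleton]
  generalize g⁻¹.toWord = w at hl
  obtain _ | ⟨hd, tl⟩ := w
  · simp at hl
  · simp only [List.length_cons, Nat.add_right_cancel_iff] at hl
    rw [← Finset.sum_erase_add _ _ (Finset.mem_univ hd)]
    congr 1
    · rw [Finset.sum_congr rfl (g := fun _ => f (k + 2))]
      · simp [Finset.card_erase_of_mem, mul_comm]
      · intro a ha
        have : ¬ (a.1 = hd.1 ∧ (!a.2) = !hd.2) := fun h =>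
          (Finset.mem_erase.1 ha).1 (Prod.ext h.1 (by simpa using h.2))
        dsimp only
        rw [if_neg this]
        simp [hl]
    · simp [hl]

/-- The transition operator of the word length: from `k ≥ 1` the length increases with probability
`(2d - 1) / (2d)` and decreases with probability `1 / (2d)`; from `0` it always increases. -/
def lengthStep (d : ℕ) (f : ℕ → ENNReal) : ℕ → ENNReal
  | 0 => f 1
  | k + 1 => ENNReal.ofReal ((2 * d - 1) / (2 * d)) * f (k + 2) +
      ENNReal.ofReal (1 / (2 * d)) * f k

lemma sum_norm_mul_mk_eq_lengthStep {d : ℕ} (hd : 1 ≤ d) (f : ℕ → ENNReal)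
    (g : FreeGroup (Fin d)) :
    ∑ a, 1 / (2 * (d : ENNReal)) * f (g * FreeGroup.mk [a]).norm = lengthStep d f g.norm := by
  have hd' : (0 : ℝ) < 2 * d := by positivity
  have hc : (1 / (2 * (d : ENNReal))) = ENNReal.ofReal (1 / (2 * d)) := by
    rw [ENNReal.ofReal_div_of_pos hd', ENNReal.ofReal_mul (by norm_num)]; simp
  rw [← Finset.mul_sum]
  rcases hk : g.norm with _ | k
  · rw [sum_norm_mul_mk_of_norm_eq_zero f hk, lengthStep, nsmul_eq_mul, ← mul_assoc]
    have : 1 / (2 * (d : ENNReal)) * ((2 * Fintype.card (Fin d) : ℕ) : ENNReal) = 1 := by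
      simp only [Fintype.card_fin, Nat.cast_mul, Nat.cast_ofNat, one_div]
      refine ENNReal.inv_mul_cancel ?_ (by finiteness)
      simp; omega
    rw [this, one_mul]
  · rw [sum_norm_mul_mk_of_norm_eq_succ f hk, lengthStep, nsmul_eq_mul, mul_add, ← mul_assoc, hc]
    congr 2
    rw [← ENNReal.ofReal_natCast, ← ENNReal.ofReal_mul (by positivity), Nat.cast_sub]
    · congr 1
      simp; ring
    · simp; omega

lemma freeGroupWalk_congr {d : ℕ} {s t : ℕ → Fin d × Bool} {n : ℕ} (h : ∀ i < n, s i = t i) :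
    freeGroupWalk s n = freeGroupWalk t n := by
  induction n with
  | zero => rfl
  | succ n ih => simp only [freeGroupWalk, ih fun i hi => h i (by omega), h n (by omega)]

/-- Factoring through a finite space makes functionals of the walk measurable and independent of the
next letter. -/
lemma exists_freeGroupWalk_eq {d : ℕ} {Ω : Type*} (hd : 1 ≤ d) (ξ : ℕ → Ω → Fin d × Bool) (n : ℕ) :
    ∃ F : (Finset.range n → Fin d × Bool) → FreeGroup (Fin d),
      ∀ ω, freeGroupWalk (fun i => ξ i ω) n = F fun i => ξ i ω := by
  refine ⟨fun t => freeGroupWalk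
    (fun i => if h : i ∈ Finset.range n then t ⟨i, h⟩ else (⟨0, hd⟩, true)) n, fun ω => ?_⟩
  exact freeGroupWalk_congr fun i hi => by simp [hi]

section Walk

variable {d : ℕ} {Ω : Type*} [MeasurableSpace Ω] {μ : Measure Ω} {ξ : ℕ → Ω → Fin d × Bool}

lemma measurable_comp_freeGroupWalk {β : Type*} [MeasurableSpace β] (hd : 1 ≤ d)
    (hmeas : ∀ i, Measurable (ξ i)) (n : ℕ) (G : FreeGroup (Fin d) → β) :
    Measurable fun ω => G (freeGroupWalk (fun i => ξ i ω) n) := by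
  obtain ⟨F, hF⟩ := exists_freeGroupWalk_eq hd ξ n
  simp only [hF]
  exact (measurable_of_finite fun t => G (F t)).comp (measurable_pi_lambda _ fun i => hmeas i)

lemma measurable_reducedLength (hd : 1 ≤ d) (hmeas : ∀ i, Measurable (ξ i)) (n : ℕ) :
    Measurable fun ω => reducedLength (fun i => ξ i ω) n :=
  measurable_comp_freeGroupWalk hd hmeas n FreeGroup.norm

/-- Splitting over the last letter and using independence leaves an average over letters, which
depends on the current word only through its length. -/
lemma lintegral_reducedLength_succ (hd : 1 ≤ d) (hmeas : ∀ i, Measurable (ξ i))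
    (hindep : iIndepFun ξ μ) (hunif : ∀ i a, μ (ξ i ⁻¹' {a}) = 1 / (2 * (d : ENNReal)))
    (f : ℕ → ENNReal) (n : ℕ) :
    ∫⁻ ω, f (reducedLength (fun i => ξ i ω) (n + 1)) ∂μ =
      ∫⁻ ω, lengthStep d f (reducedLength (fun i => ξ i ω) n) ∂μ := by
  obtain ⟨F, hF⟩ := exists_freeGroupWalk_eq hd ξ n
  have hind (a : Fin d × Bool) :
      IndepFun (fun ω => f (freeGroupWalk (fun i => ξ i ω) n * FreeGroup.mk [a]).norm)
        (fun ω => ({a} : Set (Fin d × Bool)).indicator (1 : Fin d × Bool → ENNReal) (ξ n ω)) μ := by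
    have h := hindep.indepFun_finset (Finset.range n) {n} (by simp) hmeas
    have h' := h.comp
      (φ := fun t => f (F t * FreeGroup.mk [a]).norm)
      (ψ := fun t => ({a} : Set (Fin d × Bool)).indicator (1 : Fin d × Bool → ENNReal)
        (t ⟨n, by simp⟩))
      (measurable_of_finite _) (measurable_of_finite _)
    simpa only [Function.comp_def, ← hF] using h'
  have hpt (ω : Ω) : f (reducedLength (fun i => ξ i ω) (n + 1)) =
      ∑ a, f (freeGroupWalk (fun i => ξ i ω) n * FreeGroup.mk [a]).norm *
        ({a} : Set (Fin d × Bool)).indicator (1 : Fin d × Bool → ENNReal) (ξ n ω) := by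
    rw [Finset.sum_eq_single (ξ n ω)]
    · simp [reducedLength, freeGroupWalk]
    · intro b _ hb
      simp [Ne.symm hb]
    · simp
  have hmf (a : Fin d × Bool) : Measurable fun ω =>
      f (freeGroupWalk (fun i => ξ i ω) n * FreeGroup.mk [a]).norm :=
    measurable_comp_freeGroupWalk hd hmeas n fun g => f (g * FreeGroup.mk [a]).norm
  have hmi (a : Fin d × Bool) : Measurable fun ω =>
      ({a} : Set (Fin d × Bool)).indicator (1 : Fin d × Bool → ENNReal) (ξ n ω) :=
    (measurable_of_finite (({a} : Set (Fin d × Bool)).indicator 1)).comp (hmeas n)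
  have hone (a : Fin d × Bool) :
      ∫⁻ ω, ({a} : Set (Fin d × Bool)).indicator (1 : Fin d × Bool → ENNReal) (ξ n ω) ∂μ =
        1 / (2 * (d : ENNReal)) := by
    rw [← hunif n a, ← lintegral_indicator_one (hmeas n (measurableSet_singleton a))]
    rfl
  simp_rw [hpt]
  rw [lintegral_finsetSum _ fun a _ => by exact (hmf a).mul (hmi a)]
  simp_rw [fun a => lintegral_mul_eq_lintegral_mul_lintegral_of_indepFun'' (hmf a).aemeasurable
    (hmi a).aemeasurable (hind a), hone, mul_comm _ (1 / (2 * (d : ENNReal)))]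
  rw [Finset.sum_congr rfl fun a _ => (lintegral_const_mul (1 / (2 * (d : ENNReal))) (hmf a)).symm]
  rw [← lintegral_finsetSum _ fun a _ => (hmf a).const_mul _]
  simp_rw [sum_norm_mul_mk_eq_lengthStep hd]
  rfl

end Walk

/-! ### The function `hL` and exponential moments -/

lemma hL_of_le {d : ℕ} {θ : ℝ} (h : -(1 / 2) * Real.log (2 * (d : ℝ) - 1) ≤ θ) :
    hL d θ = (2 * (d : ℝ) - 1) / (2 * d) * Real.exp θ + 1 / (2 * (d : ℝ)) * Real.exp (-θ) :=
  if_pos h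

lemma hL_of_lt {d : ℕ} (hd : 1 ≤ d) {θ : ℝ} (h : θ < -(1 / 2) * Real.log (2 * (d : ℝ) - 1)) :
    hL d θ = hL d (-(1 / 2) * Real.log (2 * (d : ℝ) - 1)) := by
  have hd' : (1 : ℝ) ≤ d := by exact_mod_cast hd
  have hs : 0 < 2 * (d : ℝ) - 1 := by linarith
  have hexp : Real.exp (1 / 2 * Real.log (2 * (d : ℝ) - 1)) = √(2 * (d : ℝ) - 1) := by
    rw [Real.sqrt_eq_rpow, Real.rpow_def_of_pos hs, mul_comm]
  rw [hL_of_le le_rfl, hL, if_neg (not_le.2 h), neg_mul, neg_neg, Real.exp_neg, hexp]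
  have h0 : 0 < √(2 * (d : ℝ) - 1) := Real.sqrt_pos.2 hs
  have hsq : √(2 * (d : ℝ) - 1) ^ 2 = 2 * d - 1 := Real.sq_sqrt hs.le
  field_simp
  rw [hsq]
  ring

lemma hL_pos {d : ℕ} (hd : 1 ≤ d) (θ : ℝ) : 0 < hL d θ := by
  have hd' : (1 : ℝ) ≤ d := by exact_mod_cast hd
  have hs : 0 < 2 * (d : ℝ) - 1 := by linarith
  unfold hL
  split_ifs <;> positivity

lemma hL_zero {d : ℕ} (hd : 1 ≤ d) : hL d 0 = 1 := by
  have hd' : (1 : ℝ) ≤ d := by exact_mod_cast hd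
  have : 0 ≤ Real.log (2 * (d : ℝ) - 1) := Real.log_nonneg (by linarith)
  rw [hL_of_le (by linarith)]
  simp only [neg_zero, Real.exp_zero]
  field_simp
  ring

/-- A superharmonic combination of the two exponentials with the same eigenvalue. -/
lemma exists_nonneg_add_mul_le {p q u : ℝ} (hq : 0 < q) (hqp : q ≤ p) (hpq : p + q = 1)
    (hu : 0 < u) :
    ∃ b : ℝ, 0 ≤ b ∧ u + b * (q / (p * u)) ≤ (p * u + q * u⁻¹) * (1 + b) := by
  have hp : 0 < p := hq.trans_le hqp
  rcases le_or_gt u 1 with h1 | h1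
  · refine ⟨0, le_rfl, ?_⟩
    have hinv : 1 ≤ u⁻¹ := (one_le_inv₀ hu).2 h1
    obtain rfl : p = 1 - q := by linarith
    nlinarith [mul_nonneg hq.le (sub_nonneg.2 (h1.trans hinv))]
  · have hr : q / (p * u) < 1 := by
      rw [div_lt_one (by positivity)]
      nlinarith
    have hr0 : 0 < q / (p * u) := by positivity
    have hqu : q * u⁻¹ = p * (q / (p * u)) := by field_simp
    have hinv : u⁻¹ < 1 := inv_lt_one_of_one_lt₀ h1
    have hgap : 0 < p * u + q * u⁻¹ - q / (p * u) := by
      rw [hqu]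
      obtain rfl : q = 1 - p := by linarith
      nlinarith
    -- This b gives equality at 0; the numerator is q(u - u⁻¹).
    refine ⟨(u - (p * u + q * u⁻¹)) / (p * u + q * u⁻¹ - q / (p * u)), div_nonneg ?_ hgap.le, ?_⟩
    · obtain rfl : p = 1 - q := by linarith
      nlinarith
    · have := div_mul_cancel₀ (u - (p * u + q * u⁻¹)) hgap.ne'
      linarith

section Walk

variable {d : ℕ} {Ω : Type*} [MeasurableSpace Ω] {μ : Measure Ω} [IsProbabilityMeasure μ]
  {ξ : ℕ → Ω → Fin d × Bool}

lemma lintegral_reducedLength_le (hd : 1 ≤ d) (hmeas : ∀ i, Measurable (ξ i))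
    (hindep : iIndepFun ξ μ) (hunif : ∀ i a, μ (ξ i ⁻¹' {a}) = 1 / (2 * (d : ENNReal)))
    {f : ℕ → ENNReal} {c : ENNReal} (hf : ∀ k, lengthStep d f k ≤ c * f k) (n : ℕ) :
    ∫⁻ ω, f (reducedLength (fun i => ξ i ω) n) ∂μ ≤ c ^ n * f 0 := by
  induction n with
  | zero => simp [reducedLength, freeGroupWalk]
  | succ n ih =>
    rw [lintegral_reducedLength_succ hd hmeas hindep hunif]
    calc _ ≤ ∫⁻ ω, c * f (reducedLength (fun i => ξ i ω) n) ∂μ := lintegral_mono fun ω => hf _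
      _ = c * ∫⁻ ω, f (reducedLength (fun i => ξ i ω) n) ∂μ :=
        lintegral_const_mul _ ((measurable_of_countable f).comp
          (measurable_reducedLength hd hmeas n))
      _ ≤ c * (c ^ n * f 0) := by gcongr
      _ = c ^ (n + 1) * f 0 := by ring

/-- The exponential moments of `L_n` grow at most like `h_L(θ) ^ n`. -/
lemma exists_lintegral_exp_reducedLength_le (hd : 1 ≤ d) (hmeas : ∀ i, Measurable (ξ i))
    (hindep : iIndepFun ξ μ) (hunif : ∀ i a, μ (ξ i ⁻¹' {a}) = 1 / (2 * (d : ENNReal))) (θ : ℝ) :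
    ∃ C : ℝ, 0 ≤ C ∧ ∀ n : ℕ,
      ∫⁻ ω, ENNReal.ofReal (Real.exp (θ * reducedLength (fun i => ξ i ω) n)) ∂μ ≤
        ENNReal.ofReal (C * hL d θ ^ n) := by
  -- Below the threshold `hL` is constant, while the moment is nondecreasing in θ because lengths
  -- are nonnegative.
  wlog hθ : -(1 / 2) * Real.log (2 * (d : ℝ) - 1) ≤ θ generalizing θ
  · obtain ⟨C, hC, h⟩ := this _ le_rfl
    refine ⟨C, hC, fun n => ?_⟩
    rw [hL_of_lt hd (not_le.1 hθ)]
    refine (lintegral_mono fun ω => ENNReal.ofReal_le_ofReal (Real.exp_le_exp.2 ?_)).trans (h n)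
    exact mul_le_mul_of_nonneg_right (not_le.1 hθ).le (Nat.cast_nonneg _)
  have hd' : (1 : ℝ) ≤ d := by exact_mod_cast hd
  have hp : 0 < (2 * (d : ℝ) - 1) / (2 * d) := div_pos (by linarith) (by linarith)
  have hq : 0 < 1 / (2 * (d : ℝ)) := by positivity
  have hqp : 1 / (2 * (d : ℝ)) ≤ (2 * (d : ℝ) - 1) / (2 * d) := by gcongr; linarith
  have hpq : (2 * (d : ℝ) - 1) / (2 * d) + 1 / (2 * (d : ℝ)) = 1 := by field_simp; ring
  have hpos := hL_pos hd θ
  have hh := hL_of_le hθ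
  rw [Real.exp_neg] at hh
  have hu : 0 < Real.exp θ := Real.exp_pos θ
  have hexp (k : ℕ) : Real.exp (θ * k) = Real.exp θ ^ k := by
    rw [mul_comm, Real.exp_nat_mul]
  simp only [hexp]
  generalize Real.exp θ = u at *
  generalize hL d θ = h at *
  obtain ⟨b, hb, hbu⟩ := exists_nonneg_add_mul_le hq hqp hpq hu
  -- At k ≥ 1 this is the common eigenvalue equation; at 0 it is the choice of b.
  have hstep : ∀ k, lengthStep d (fun k => ENNReal.ofReal (u ^ k + b *
      (1 / (2 * (d : ℝ)) / ((2 * (d : ℝ) - 1) / (2 * d) * u)) ^ k)) k ≤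
      ENNReal.ofReal h * ENNReal.ofReal (u ^ k + b *
      (1 / (2 * (d : ℝ)) / ((2 * (d : ℝ) - 1) / (2 * d) * u)) ^ k) := by
    intro k
    rw [← ENNReal.ofReal_mul hpos.le]
    cases k with
    | zero =>
      simp only [lengthStep]
      refine ENNReal.ofReal_le_ofReal ?_
      rw [hh]
      simpa using hbu
    | succ k =>
      simp only [lengthStep]
      rw [← ENNReal.ofReal_mul hp.le, ← ENNReal.ofReal_mul hq.le,
        ← ENNReal.ofReal_add (by positivity) (by positivity)]
      refine ENNReal.ofReal_le_ofReal (le_of_eq ?_)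
      rw [hh]
      generalize (2 * (d : ℝ) - 1) / (2 * d) = p at *
      generalize 1 / (2 * (d : ℝ)) = q at *
      have hr : q = p * u * (q / (p * u)) := by field_simp
      generalize q / (p * u) = r at *
      subst hr
      field_simp
      ring
  refine ⟨1 + b, by positivity, fun n => ?_⟩
  calc _ ≤ ∫⁻ ω, ENNReal.ofReal (u ^ reducedLength (fun i => ξ i ω) n + b *
      (1 / (2 * (d : ℝ)) / ((2 * (d : ℝ) - 1) / (2 * d) * u)) ^
        reducedLength (fun i => ξ i ω) n) ∂μ := by
        refine lintegral_mono fun ω => ENNReal.ofReal_le_ofReal ?_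
        have : 0 ≤ b * (1 / (2 * (d : ℝ)) / ((2 * (d : ℝ) - 1) / (2 * d) * u)) ^
          reducedLength (fun i => ξ i ω) n := by positivity
        linarith
    _ ≤ _ := lintegral_reducedLength_le hd hmeas hindep hunif hstep n
    _ = ENNReal.ofReal ((1 + b) * h ^ n) := by
        rw [← ENNReal.ofReal_pow hpos.le, ← ENNReal.ofReal_mul (by positivity)]
        congr 1
        simp [mul_comm]

end Walk

/-! ### Upper bound from exponential moments -/

lemma isRateFunction_legendreTransform {Λ : ℝ → ℝ} (h0 : Λ 0 = 0) :
    IsRateFunction (legendreTransform Λ) where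
  nonneg x := le_iSup_of_le 0 (by simp [h0])
  lowerSemicontinuous := lowerSemicontinuous_iSup fun θ => Continuous.lowerSemicontinuous
    (continuous_coe_real_ereal.comp (by fun_prop))

/-- Markov's inequality for e^{nθy}, on the set where the single parameter θ already certifies the
rate M. -/
lemma measure_le_of_lintegral_exp_le {ν : ℕ → Measure ℝ} {Λ : ℝ → ℝ} {M θ C : ℝ}
    (h : ∀ n : ℕ, ∫⁻ x, ENNReal.ofReal (Real.exp (n * (θ * x))) ∂ν n ≤
      ENNReal.ofReal (C * Real.exp (n * Λ θ))) (n : ℕ) :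
    ν n {y | M < θ * y - Λ θ} ≤ ENNReal.ofReal (C * Real.exp (-(n * M))) := by
  set a := Real.exp (n * (M + Λ θ)) with ha
  have ha0 : 0 < a := Real.exp_pos _
  have hsub : {y | M < θ * y - Λ θ} ⊆
      {y | ENNReal.ofReal a ≤ ENNReal.ofReal (Real.exp (n * (θ * y)))} := by
    intro y (hy : M < θ * y - Λ θ)
    refine ENNReal.ofReal_le_ofReal (Real.exp_le_exp.2 ?_)
    exact mul_le_mul_of_nonneg_left (by linarith) (Nat.cast_nonneg _)
  have hm := (mul_meas_ge_le_lintegral (μ := ν n)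
    (f := fun y => ENNReal.ofReal (Real.exp (n * (θ * y)))) (by fun_prop)
    (ENNReal.ofReal a)).trans (h n)
  have hprod : C * Real.exp (n * Λ θ) = a * (C * Real.exp (-(n * M))) := by
    rw [ha, mul_left_comm, ← Real.exp_add]
    ring_nf
  rw [hprod, ENNReal.ofReal_mul ha0.le] at hm
  exact (measure_mono hsub).trans ((ENNReal.mul_le_mul_iff_right
    (ENNReal.ofReal_pos.2 ha0).ne' ENNReal.ofReal_ne_top).1 hm)

/-- Each point of K has a neighbourhood with one certifying θ; finitely many cover K, and the union
only adds the constants. -/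
lemma IsCompact.exists_measure_le_of_lt_legendreTransform {ν : ℕ → Measure ℝ} {Λ : ℝ → ℝ}
    (h : ∀ θ, ∃ C : ℝ, 0 ≤ C ∧ ∀ n : ℕ, ∫⁻ x, ENNReal.ofReal (Real.exp (n * (θ * x))) ∂ν n ≤
      ENNReal.ofReal (C * Real.exp (n * Λ θ)))
    {K : Set ℝ} (hK : IsCompact K) {M : ℝ} (hM : ∀ x ∈ K, (M : EReal) < legendreTransform Λ x) :
    ∃ C : ℝ, 0 ≤ C ∧ ∀ n, ν n K ≤ ENNReal.ofReal (C * Real.exp (-(n * M))) := by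
  refine hK.induction_on (p := fun S => ∃ C : ℝ, 0 ≤ C ∧ ∀ n, ν n S ≤
    ENNReal.ofReal (C * Real.exp (-(n * M)))) ⟨0, le_rfl, by simp⟩ ?_ ?_ ?_
  · rintro s t hst ⟨C, hC, hC'⟩
    exact ⟨C, hC, fun n => (measure_mono hst).trans (hC' n)⟩
  · rintro s t ⟨C, hC, hC'⟩ ⟨D, hD, hD'⟩
    refine ⟨C + D, by positivity, fun n => (measure_union_le s t).trans ?_⟩
    rw [add_mul, ENNReal.ofReal_add (by positivity) (by positivity)]
    exact add_le_add (hC' n) (hD' n)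
  · intro x hx
    obtain ⟨θ, hθ⟩ := lt_iSup_iff.1 (hM x hx)
    obtain ⟨C, hC, hC'⟩ := h θ
    refine ⟨{y | M < θ * y - Λ θ}, mem_nhdsWithin_of_mem_nhds ?_, C, hC,
      measure_le_of_lintegral_exp_le hC'⟩
    exact (isOpen_lt continuous_const (by fun_prop)).mem_nhds (by exact_mod_cast hθ)

lemma limsup_log_div_le_of_le {u : ℕ → ENNReal} {C M : ℝ}
    (h : ∀ n : ℕ, u n ≤ ENNReal.ofReal (C * Real.exp (-(n * M)))) :
    limsup (fun n : ℕ => ENNReal.log (u n) / (n : EReal)) atTop ≤ ((-M : ℝ) : EReal) := by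
  wlog hC : 0 < C generalizing C
  · refine this (C := 1) (fun n => (h n).trans (ENNReal.ofReal_le_ofReal ?_)) one_pos
    gcongr
    linarith
  have ht : Tendsto (fun n : ℕ => ((Real.log C / n - M : ℝ) : EReal)) atTop (𝓝 ((-M : ℝ))) := by
    refine (continuous_coe_real_ereal.tendsto _).comp ?_
    simpa using (tendsto_const_div_atTop_nhds_zero_nat (Real.log C)).sub_const M
  rw [← ht.limsup_eq]
  refine limsup_le_limsup ?_
  filter_upwards [eventually_gt_atTop 0] with n hn
  have hn' : (0 : ℝ) < n := by exact_mod_cast hn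
  refine (EReal.div_le_div_right_of_nonneg (by positivity)
    (ENNReal.log_le_log (h n))).trans (le_of_eq ?_)
  rw [ENNReal.log_ofReal_of_pos (by positivity), Real.log_mul hC.ne' (Real.exp_ne_zero _),
    Real.log_exp, ← EReal.coe_coe_eq_natCast, ← EReal.coe_div, EReal.coe_eq_coe_iff]
  field_simp
  ring

/-- The large deviations upper bound for measures on a common compact set, from bounds on their
exponential moments. -/
lemma limsup_log_measure_le_of_lintegral_exp_le {ν : ℕ → Measure ℝ} {Λ : ℝ → ℝ} {K : Set ℝ}
    (hK : IsCompact K) (hνK : ∀ n, ν n Kᶜ = 0)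
    (h : ∀ θ, ∃ C : ℝ, 0 ≤ C ∧ ∀ n : ℕ, ∫⁻ x, ENNReal.ofReal (Real.exp (n * (θ * x))) ∂ν n ≤
      ENNReal.ofReal (C * Real.exp (n * Λ θ))) (Γ : Set ℝ) :
    limsup (fun n : ℕ => ENNReal.log (ν n Γ) / (n : EReal)) atTop ≤
      -(⨅ x ∈ closure Γ, legendreTransform Λ x) := by
  rw [EReal.le_neg]
  refine EReal.ge_of_forall_gt_iff_ge.1 fun M hM => ?_
  obtain ⟨C, hC, hC'⟩ := (hK.inter_left (isClosed_closure (s := Γ))).exists_measure_le_of_lt_legendreTransform h (M := M)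
    fun x hx => hM.trans_le (iInf₂_le x hx.1)
  rw [EReal.le_neg, ← EReal.coe_neg]
  refine limsup_log_div_le_of_le (C := C) fun n => le_trans ?_ (hC' n)
  calc ν n Γ ≤ ν n (closure Γ ∩ K ∪ Kᶜ) := measure_mono fun x hx => by
        by_cases hxK : x ∈ K
        · exact Or.inl ⟨subset_closure hx, hxK⟩
        · exact Or.inr hxK
    _ ≤ ν n (closure Γ ∩ K) + ν n Kᶜ := measure_union_le _ _
    _ = ν n (closure Γ ∩ K) := by rw [hνK, add_zero]

/-! ### Binomial coefficients and ballot numbers -/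

open Nat in
-- The quotient a^m / m! is largest at m = a.
lemma pow_mul_factorial_le (a m : ℕ) : a ^ m * a ! ≤ a ^ a * m ! := by
  rcases le_total a m with h | h
  · calc a ^ m * a ! = a ^ a * (a ! * a ^ (m - a)) := by
          rw [mul_left_comm, ← pow_add, Nat.add_sub_cancel' h, mul_comm]
      _ ≤ a ^ a * m ! := Nat.mul_le_mul_left _ (Nat.factorial_mul_pow_sub_le_factorial h)
  · have key : a ! ≤ m ! * a ^ (a - m) := by
      rw [← Nat.factorial_mul_descFactorial (Nat.sub_le a m), Nat.sub_sub_self h]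
      exact Nat.mul_le_mul_left _ (Nat.descFactorial_le_pow _ _)
    calc a ^ m * a ! ≤ a ^ m * (m ! * a ^ (a - m)) := Nat.mul_le_mul_left _ key
      _ = a ^ a * m ! := by rw [mul_left_comm, ← pow_add, Nat.add_sub_cancel' h, mul_comm]

open Nat in
/-- The largest term of the binomial expansion of `(a + b) ^ (a + b)`. -/
lemma pow_mul_pow_mul_choose_le (a b i j : ℕ) (h : i + j = a + b) :
    a ^ i * b ^ j * (i + j).choose i ≤ a ^ a * b ^ b * (a + b).choose a := by
  refine Nat.le_of_mul_le_mul_right (c := i ! * j ! * (a ! * b !)) ?_ (by positivity)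
  have h1 := Nat.add_choose_mul_factorial_mul_factorial i j
  have h2 := Nat.add_choose_mul_factorial_mul_factorial a b
  rw [← Nat.choose_symm_add] at h1 h2
  calc a ^ i * b ^ j * (i + j).choose i * (i ! * j ! * (a ! * b !))
      = (a ^ i * a !) * (b ^ j * b !) * ((i + j).choose i * i ! * j !) := by ring
    _ ≤ (a ^ a * i !) * (b ^ b * j !) * ((i + j).choose i * i ! * j !) := by
        exact Nat.mul_le_mul_right _
          (Nat.mul_le_mul (pow_mul_factorial_le a i) (pow_mul_factorial_le b j))
    _ = a ^ a * b ^ b * (a + b).choose a * (i ! * j ! * (a ! * b !)) := by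
        rw [h1, h, ← h2]; ring

lemma add_pow_add_le_mul_choose (a b : ℕ) :
    (a + b) ^ (a + b) ≤ (a + b + 1) * ((a + b).choose a * (a ^ a * b ^ b)) := by
  rw [add_pow]
  calc _ ≤ ∑ _m ∈ Finset.range (a + b + 1), (a + b).choose a * (a ^ a * b ^ b) := by
        refine Finset.sum_le_sum fun m hm => ?_
        have hm' : m + (a + b - m) = a + b := by
          have := Finset.mem_range.1 hm
          omega
        have := pow_mul_pow_mul_choose_le a b m (a + b - m) hm'
        rw [hm'] at this
        simpa [mul_comm, mul_left_comm, mul_assoc] using this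
    _ = _ := by simp

/-- The number of nonnegative nearest neighbour paths on `ℤ` from `0` to `k` with `b` down steps. -/
def ballotNumber : ℕ → ℕ → ℝ
  | 0, _ => 1
  | b + 1, k => (2 * (b + 1) + k).choose (b + 1) - (2 * (b + 1) + k).choose b

/-- Last-step decomposition: a path ending at k + 1 comes from k or k + 2. Algebraically, it is
Pascal's rule applied to both terms of the reflection formula. -/
lemma ballotNumber_succ_succ (b k : ℕ) :
    ballotNumber (b + 1) (k + 1) = ballotNumber (b + 1) k + ballotNumber b (k + 2) := by
  have h1 : (2 * (b + 1) + (k + 1)).choose (b + 1) =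
      (2 * (b + 1) + k).choose b + (2 * (b + 1) + k).choose (b + 1) := by
    rw [← Nat.choose_succ_succ]; rfl
  cases b with
  | zero =>
    simp only [ballotNumber, h1]
    simp
  | succ b =>
    have h2 : (2 * (b + 1 + 1) + (k + 1)).choose (b + 1) =
        (2 * (b + 1 + 1) + k).choose b + (2 * (b + 1 + 1) + k).choose (b + 1) := by
      rw [← Nat.choose_succ_succ]; rfl
    have h3 : 2 * (b + 1) + (k + 2) = 2 * (b + 1 + 1) + k := by ring
    simp only [ballotNumber, h1, h2, h3]
    push_cast
    ring

lemma ballotNumber_succ_zero (b : ℕ) : ballotNumber (b + 1) 0 = ballotNumber b 1 := by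
  have h1 : (2 * (b + 1) + 0).choose (b + 1) =
      (2 * b + 1).choose b + (2 * b + 1).choose (b + 1) := by
    rw [← Nat.choose_succ_succ]; rfl
  have hs : (2 * b + 1).choose (b + 1) = (2 * b + 1).choose b := by
    rw [← Nat.choose_symm_half]
  cases b with
  | zero => norm_num [ballotNumber]
  | succ b =>
    have h2 : (2 * (b + 1 + 1) + 0).choose (b + 1) =
        (2 * (b + 1) + 1).choose b + (2 * (b + 1) + 1).choose (b + 1) := by
      rw [← Nat.choose_succ_succ]; rfl
    simp only [ballotNumber, h1, h2, hs]
    push_cast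
    ring

/-- The ratio of ballot number to binomial coefficient is (k+1)/(b+k+1), so staying nonnegative
costs only a polynomial factor. -/
lemma choose_le_mul_ballotNumber (b k : ℕ) :
    ((2 * b + k).choose b : ℝ) ≤ (2 * b + k + 1) * ballotNumber b k := by
  cases b with
  | zero => simp [ballotNumber]
  | succ b =>
    have h := Nat.choose_succ_right_eq (2 * (b + 1) + k) b
    rw [show 2 * (b + 1) + k - b = b + k + 2 by omega] at h
    have h' : ((2 * (b + 1) + k).choose (b + 1) : ℝ) * (b + 1) =
      (2 * (b + 1) + k).choose b * (b + k + 2) := by exact_mod_cast h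
    simp only [ballotNumber]
    have hc : (0 : ℝ) ≤ (2 * (b + 1) + k).choose (b + 1) := by positivity
    have hpos : (0 : ℝ) < b + k + 2 := by positivity
    generalize ((2 * (b + 1) + k).choose (b + 1) : ℝ) = x at *
    generalize ((2 * (b + 1) + k).choose b : ℝ) = y at *
    obtain rfl : y = x * (b + 1) / (b + k + 2) := by field_simp; linarith
    have e : (2 * ((b + 1 : ℕ) : ℝ) + k + 1) * (x - x * (b + 1) / (b + k + 2)) =
      x * ((2 * (b : ℝ) + k + 3) * (k + 1) / (b + k + 2)) := by
      push_cast; field_simp; ring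
    rw [e]
    refine le_mul_of_one_le_right hc ((one_le_div hpos).2 ?_)
    have : (0 : ℝ) ≤ b * k := by positivity
    nlinarith [sq_nonneg (k : ℝ)]

/-! ### Local lower bounds for the length -/

section Walk

variable {d : ℕ} {Ω : Type*} [MeasurableSpace Ω] {μ : Measure Ω} {ξ : ℕ → Ω → Fin d × Bool}

lemma ofReal_lengthStep_prob_le_one (hd : 1 ≤ d) :
    ENNReal.ofReal ((2 * d - 1) / (2 * d)) ≤ 1 := by
  rw [ENNReal.ofReal_le_one, div_le_one (by positivity)]
  linarith

lemma lintegral_single_reducedLength (hd : 1 ≤ d) (hmeas : ∀ i, Measurable (ξ i))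
    (n k : ℕ) (c : ENNReal) :
    ∫⁻ ω, c * (Pi.single k 1 : ℕ → ENNReal) (reducedLength (fun i => ξ i ω) n) ∂μ =
      c * μ {ω | reducedLength (fun i => ξ i ω) n = k} := by
  have hset : MeasurableSet {ω | reducedLength (fun i => ξ i ω) n = k} :=
    measurable_reducedLength hd hmeas n (measurableSet_singleton k)
  rw [← lintegral_indicator_one hset, ← lintegral_const_mul _ (measurable_one.indicator hset)]
  refine lintegral_congr fun ω => ?_
  simp [Pi.single_apply, Set.indicator_apply]

variable [IsProbabilityMeasure μ]

/-- Allowing a minorant g of the transition probability to k avoids separate treatment of the step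
out of 0. -/
lemma le_measureReal_reducedLength_succ (hd : 1 ≤ d) (hmeas : ∀ i, Measurable (ξ i))
    (hindep : iIndepFun ξ μ) (hunif : ∀ i a, μ (ξ i ⁻¹' {a}) = 1 / (2 * (d : ENNReal)))
    (n k : ℕ) (g : ℕ → ENNReal) (hg : ∀ j, g j ≤ lengthStep d (Pi.single k 1) j) :
    (∫⁻ ω, g (reducedLength (fun i => ξ i ω) n) ∂μ).toReal ≤
      μ.real {ω | reducedLength (fun i => ξ i ω) (n + 1) = k} := by
  have hset : MeasurableSet {ω | reducedLength (fun i => ξ i ω) (n + 1) = k} :=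
    measurable_reducedLength hd hmeas (n + 1) (measurableSet_singleton k)
  refine ENNReal.toReal_mono (measure_ne_top _ _) ?_
  calc _ ≤ ∫⁻ ω, lengthStep d (Pi.single k 1) (reducedLength (fun i => ξ i ω) n) ∂μ :=
        lintegral_mono fun ω => hg _
    _ = _ := (lintegral_reducedLength_succ hd hmeas hindep hunif _ n).symm
    _ = ∫⁻ ω, {ω | reducedLength (fun i => ξ i ω) (n + 1) = k}.indicator 1 ω ∂μ := by
        refine lintegral_congr fun ω => ?_
        simp [Pi.single_apply, Set.indicator_apply]
    _ = _ := lintegral_indicator_one hset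

lemma le_measureReal_reducedLength_succ_succ (hd : 1 ≤ d) (hmeas : ∀ i, Measurable (ξ i))
    (hindep : iIndepFun ξ μ) (hunif : ∀ i a, μ (ξ i ⁻¹' {a}) = 1 / (2 * (d : ENNReal)))
    (n k : ℕ) :
    (2 * d - 1) / (2 * d) * μ.real {ω | reducedLength (fun i => ξ i ω) n = k} +
        1 / (2 * d) * μ.real {ω | reducedLength (fun i => ξ i ω) n = k + 2} ≤
      μ.real {ω | reducedLength (fun i => ξ i ω) (n + 1) = k + 1} := by
  have hd' : (1 : ℝ) ≤ d := by exact_mod_cast hd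
  have hp : 0 ≤ (2 * (d : ℝ) - 1) / (2 * d) := div_nonneg (by linarith) (by linarith)
  have hq : 0 ≤ 1 / (2 * (d : ℝ)) := by positivity
  refine le_trans (le_of_eq ?_) (le_measureReal_reducedLength_succ hd hmeas hindep hunif n (k + 1)
    (fun j => ENNReal.ofReal ((2 * d - 1) / (2 * d)) * (Pi.single k 1 : ℕ → ENNReal) j +
      ENNReal.ofReal (1 / (2 * d)) * (Pi.single (k + 2) 1 : ℕ → ENNReal) j) fun j => ?_)
  · have hm : Measurable fun ω => ENNReal.ofReal ((2 * d - 1) / (2 * d)) *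
        (Pi.single k 1 : ℕ → ENNReal) (reducedLength (fun i => ξ i ω) n) :=
      (measurable_of_countable fun j => ENNReal.ofReal ((2 * d - 1) / (2 * d)) *
        (Pi.single k 1 : ℕ → ENNReal) j).comp (measurable_reducedLength hd hmeas n)
    rw [lintegral_add_left hm, lintegral_single_reducedLength hd hmeas, lintegral_single_reducedLength hd hmeas,
      ENNReal.toReal_add (by finiteness) (by finiteness), ENNReal.toReal_mul, ENNReal.toReal_mul,
      ENNReal.toReal_ofReal hp, ENNReal.toReal_ofReal hq]
    rfl
  · have hp1 := ofReal_lengthStep_prob_le_one hd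
    cases j with
    | zero =>
      rcases eq_or_ne k 0 with rfl | hk
      · simpa [lengthStep] using hp1
      · simp [lengthStep, hk.symm]
    | succ j =>
      simp [lengthStep, Pi.single_apply]

lemma le_measureReal_reducedLength_succ_zero (hd : 1 ≤ d) (hmeas : ∀ i, Measurable (ξ i))
    (hindep : iIndepFun ξ μ) (hunif : ∀ i a, μ (ξ i ⁻¹' {a}) = 1 / (2 * (d : ENNReal)))
    (n : ℕ) :
    1 / (2 * d) * μ.real {ω | reducedLength (fun i => ξ i ω) n = 1} ≤
      μ.real {ω | reducedLength (fun i => ξ i ω) (n + 1) = 0} := by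
  refine le_trans (le_of_eq ?_) (le_measureReal_reducedLength_succ hd hmeas hindep hunif n 0
    (fun j => ENNReal.ofReal (1 / (2 * d)) * (Pi.single 1 1 : ℕ → ENNReal) j) fun j => ?_)
  · rw [lintegral_single_reducedLength hd hmeas, ENNReal.toReal_mul,
      ENNReal.toReal_ofReal (by positivity)]
    rfl
  · cases j with
    | zero => simp
    | succ j => simp [lengthStep, Pi.single_apply]

/-- Counting the paths of the word length on which it behaves like a walk on `ℤ`. -/
lemma ballotNumber_mul_le_measureReal (hd : 1 ≤ d) (hmeas : ∀ i, Measurable (ξ i))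
    (hindep : iIndepFun ξ μ) (hunif : ∀ i a, μ (ξ i ⁻¹' {a}) = 1 / (2 * (d : ENNReal)))
    (b k : ℕ) :
    ballotNumber b k * ((2 * d - 1) / (2 * d)) ^ (b + k) * (1 / (2 * d)) ^ b ≤
      μ.real {ω | reducedLength (fun i => ξ i ω) (2 * b + k) = k} := by
  have hd' : (1 : ℝ) ≤ d := by exact_mod_cast hd
  have hp : 0 ≤ (2 * (d : ℝ) - 1) / (2 * d) := div_nonneg (by linarith) (by linarith)
  have hq : 0 ≤ 1 / (2 * (d : ℝ)) := by positivity
  -- The nested induction follows the ballot recursions: (b+1, k+1) needs (b+1, k) and (b, k+2).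
  induction b generalizing k with
  | zero =>
    induction k with
    | zero => simp [reducedLength, freeGroupWalk, ballotNumber]
    | succ k ih =>
      have h := le_measureReal_reducedLength_succ_succ hd hmeas hindep hunif (2 * 0 + k) k
      refine le_trans ?_ h
      have h1 := mul_le_mul_of_nonneg_left ih hp
      have h2 := mul_nonneg hq (measureReal_nonneg (μ := μ)
        (s := {ω | reducedLength (fun i => ξ i ω) (2 * 0 + k) = k + 2}))
      refine le_trans (le_of_eq ?_) (h1.trans (le_add_of_nonneg_right h2))
      simp only [ballotNumber]
      ring
  | succ b ihb =>
    induction k with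
    | zero =>
      have h := le_measureReal_reducedLength_succ_zero hd hmeas hindep hunif (2 * b + 1)
      refine le_trans (le_of_eq ?_) ((mul_le_mul_of_nonneg_left (ihb 1) hq).trans h)
      rw [ballotNumber_succ_zero]
      ring
    | succ k ih =>
      have h := le_measureReal_reducedLength_succ_succ hd hmeas hindep hunif (2 * (b + 1) + k) k
      refine le_trans (le_of_eq ?_) ((add_le_add (mul_le_mul_of_nonneg_left ih hp)
        (mul_le_mul_of_nonneg_left (ihb (k + 2)) hq)).trans (le_trans (le_of_eq ?_) h))
      · rw [ballotNumber_succ_succ]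
        ring
      · rw [show 2 * b + (k + 2) = 2 * (b + 1) + k by ring]

/-- The entropic lower bound for the local probabilities of `L_n`. -/
lemma pow_mul_pow_le_measureReal (hd : 1 ≤ d) (hmeas : ∀ i, Measurable (ξ i))
    (hindep : iIndepFun ξ μ) (hunif : ∀ i a, μ (ξ i ⁻¹' {a}) = 1 / (2 * (d : ENNReal)))
    {n b : ℕ} (hb : 2 * b ≤ n) :
    (n : ℝ) ^ n * ((2 * d - 1) / (2 * d)) ^ (n - b) * (1 / (2 * d)) ^ b ≤
      (n + 1) ^ 2 * (((n - b : ℕ) : ℝ) ^ (n - b) * (b : ℝ) ^ b) *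
        μ.real {ω | reducedLength (fun i => ξ i ω) n = n - 2 * b} := by
  obtain ⟨k, rfl⟩ := Nat.exists_eq_add_of_le hb
  have hd' : (1 : ℝ) ≤ d := by exact_mod_cast hd
  have hp : 0 ≤ (2 * (d : ℝ) - 1) / (2 * d) := div_nonneg (by linarith) (by linarith)
  have hq : 0 ≤ 1 / (2 * (d : ℝ)) := by positivity
  have h1 := ballotNumber_mul_le_measureReal hd hmeas hindep hunif b k
  have h2 := choose_le_mul_ballotNumber b k
  have h3 := add_pow_add_le_mul_choose b (b + k)
  rw [show b + (b + k) = 2 * b + k by ring] at h3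
  have h3' : ((2 * b + k : ℕ) : ℝ) ^ (2 * b + k) ≤ (2 * b + k + 1) *
    ((2 * b + k).choose b * ((b : ℝ) ^ b * ((b + k : ℕ) : ℝ) ^ (b + k))) := by exact_mod_cast h3
  rw [show 2 * b + k - b = b + k by omega, show 2 * b + k - 2 * b = k by omega]
  generalize (2 * (d : ℝ) - 1) / (2 * d) = p at *
  generalize 1 / (2 * (d : ℝ)) = q at *
  -- One factor n + 1 comes from the binomial expansion, the other from the ballot numbers.
  calc _ ≤ (2 * b + k + 1) * ((2 * b + k + 1) * ballotNumber b k *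
        ((b : ℝ) ^ b * ((b + k : ℕ) : ℝ) ^ (b + k))) * p ^ (b + k) * q ^ b := by
        gcongr
        refine h3'.trans ?_
        gcongr
    _ = (2 * b + k + 1) ^ 2 * (((b + k : ℕ) : ℝ) ^ (b + k) * (b : ℝ) ^ b) *
        (ballotNumber b k * p ^ (b + k) * q ^ b) := by ring
    _ ≤ _ := by
        push_cast
        gcongr

end Walk

/-! ### Legendre transform and entropy -/

/-- Minus the rate function on `[0, 1]`: the exponential growth rate of the probability that a
walk with step probabilities `(2d - 1) / (2d)` and `1 / (2d)` has speed `x`. -/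
def speedEntropy (d : ℕ) (x : ℝ) : ℝ :=
  Real.negMulLog ((1 + x) / 2) + Real.negMulLog ((1 - x) / 2) +
    (1 + x) / 2 * Real.log ((2 * d - 1) / (2 * d)) + (1 - x) / 2 * Real.log (1 / (2 * d))

lemma continuous_speedEntropy (d : ℕ) : Continuous (speedEntropy d) := by
  unfold speedEntropy
  fun_prop

/-- For θ ≥ 0 one has log h_L(θ) ≤ θ, so the supremum is at least θ(x - 1), which is unbounded. -/
lemma legendreTransform_log_hL_of_one_lt {d : ℕ} (hd : 1 ≤ d) {x : ℝ} (hx : 1 < x) :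
    legendreTransform (fun θ => Real.log (hL d θ)) x = ⊤ := by
  refine (EReal.eq_top_iff_forall_lt _).2 fun y => ?_
  have hd' : (1 : ℝ) ≤ d := by exact_mod_cast hd
  have hx' : 0 < x - 1 := by linarith
  set θ := (|y| + 1) / (x - 1) with hθ
  have hθ0 : 0 ≤ θ := by positivity
  have hθx : θ * (x - 1) = |y| + 1 := div_mul_cancel₀ _ hx'.ne'
  have hlog : Real.log (hL d θ) ≤ θ := by
    rw [Real.log_le_iff_le_exp (hL_pos hd θ)]
    have : 0 ≤ Real.log (2 * (d : ℝ) - 1) := Real.log_nonneg (by linarith)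
    rw [hL_of_le (by linarith)]
    have he : Real.exp (-θ) ≤ Real.exp θ := Real.exp_le_exp.2 (by linarith)
    calc _ ≤ (2 * (d : ℝ) - 1) / (2 * d) * Real.exp θ + 1 / (2 * (d : ℝ)) * Real.exp θ := by
          gcongr
      _ = Real.exp θ := by field_simp; ring
  refine lt_of_lt_of_le ?_ (le_iSup _ θ)
  rw [EReal.coe_lt_coe_iff]
  have := le_abs_self y
  linarith

/-- As θ → -∞, log h_L stays constant while θx → ∞. -/
lemma legendreTransform_log_hL_of_neg {d : ℕ} (hd : 1 ≤ d) {x : ℝ} (hx : x < 0) :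
    legendreTransform (fun θ => Real.log (hL d θ)) x = ⊤ := by
  refine (EReal.eq_top_iff_forall_lt _).2 fun y => ?_
  have hx' : 0 < -x := by linarith
  set θ₀ := -(1 / 2) * Real.log (2 * (d : ℝ) - 1)
  set c := Real.log (hL d θ₀)
  set θ := -((|y| + |c| + 1) / (-x) + |θ₀| + 1) with hθ
  have hθx : θ * x = |y| + |c| + 1 + (|θ₀| + 1) * (-x) := by
    have := div_mul_cancel₀ (|y| + |c| + 1) hx'.ne'
    rw [hθ]
    linear_combination this
  have hθ0 : θ < θ₀ := by
    have h1 : 0 ≤ (|y| + |c| + 1) / (-x) := by positivity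
    have := neg_abs_le θ₀
    linarith
  refine lt_of_lt_of_le ?_ (le_iSup _ θ)
  rw [EReal.coe_lt_coe_iff]
  dsimp only
  rw [hL_of_lt hd hθ0]
  have h1 := le_abs_self y
  have h2 := le_abs_self c
  have h3 : 0 ≤ (|θ₀| + 1) * (-x) := by positivity
  change y < θ * x - c
  linarith

lemma neg_speedEntropy_le_legendreTransform {d : ℕ} (hd : 1 ≤ d) {x : ℝ} (hx0 : 0 ≤ x)
    (hx1 : x ≤ 1) :
    ((-speedEntropy d x : ℝ) : EReal) ≤ legendreTransform (fun θ => Real.log (hL d θ)) x := by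
  have hd' : (1 : ℝ) ≤ d := by exact_mod_cast hd
  have hp : 0 < (2 * (d : ℝ) - 1) / (2 * d) := div_pos (by linarith) (by linarith)
  have hq : 0 < 1 / (2 * (d : ℝ)) := by positivity
  have hlog0 : 0 ≤ Real.log (2 * (d : ℝ) - 1) := Real.log_nonneg (by linarith)
  rcases hx1.lt_or_eq with hx1 | rfl
  · have hlogp : Real.log ((2 * (d : ℝ) - 1) / (2 * d)) =
        Real.log (2 * (d : ℝ) - 1) + Real.log (1 / (2 * (d : ℝ))) := by
      rw [← Real.log_mul (by linarith) hq.ne']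
      ring_nf
    have hα : 0 < (1 + x) / 2 := by linarith
    have hβ : 0 < (1 - x) / 2 := by linarith
    have hlogαβ : Real.log ((1 - x) / 2) ≤ Real.log ((1 + x) / 2) :=
      Real.log_le_log hβ (by linarith)
    set σ := (Real.log ((2 * (d : ℝ) - 1) / (2 * d)) + Real.log (1 / (2 * (d : ℝ))) -
      Real.log ((1 + x) / 2) - Real.log ((1 - x) / 2)) / 2 with hσ
    -- The maximizer: p e^θ = ((1+x)/2) e^σ and q e^{-θ} = ((1-x)/2) e^σ, so h_L(θ) = e^σ. It lies
    -- above the threshold precisely because x ≥ 0.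
    set θ := Real.log ((1 + x) / 2) + σ - Real.log ((2 * (d : ℝ) - 1) / (2 * d)) with hθ
    have hθ' : -θ = Real.log ((1 - x) / 2) + σ - Real.log (1 / (2 * (d : ℝ))) := by
      rw [hθ, hσ]
      ring
    have hh : Real.log (hL d θ) = σ := by
      rw [hL_of_le (by linarith), hθ', hθ, Real.exp_sub, Real.exp_sub, Real.exp_add, Real.exp_add,
        Real.exp_log hα, Real.exp_log hβ, Real.exp_log hp, Real.exp_log hq,
        mul_div_cancel₀ _ hp.ne', mul_div_cancel₀ _ hq.ne', ← add_mul,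
        show (1 + x) / 2 + (1 - x) / 2 = 1 by ring, one_mul, Real.log_exp]
    refine le_iSup_of_le θ ?_
    rw [EReal.coe_le_coe_iff]
    dsimp only
    rw [hh, speedEntropy, Real.negMulLog, Real.negMulLog]
    have hx : θ * x = (1 + x) / 2 * θ + (1 - x) / 2 * -θ := by ring
    rw [hx, hθ', hθ]
    apply le_of_eq
    ring
  · have hval : -speedEntropy d 1 = -Real.log ((2 * (d : ℝ) - 1) / (2 * d)) := by
      norm_num [speedEntropy]
    rw [hval]
    -- At x = 1 the supremum is approached only as θ → ∞.
    have ht : Tendsto (fun θ : ℝ => ((-Real.log ((2 * (d : ℝ) - 1) / (2 * d) +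
        1 / (2 * (d : ℝ)) * Real.exp (-θ) ^ 2) : ℝ) : EReal)) atTop
        (𝓝 ((-Real.log ((2 * (d : ℝ) - 1) / (2 * d)) : ℝ) : EReal)) := by
      refine (continuous_coe_real_ereal.tendsto _).comp (Tendsto.neg (Tendsto.log ?_ hp.ne'))
      simpa using ((Real.tendsto_exp_neg_atTop_nhds_zero.pow 2).const_mul
        (1 / (2 * (d : ℝ)))).const_add ((2 * (d : ℝ) - 1) / (2 * d))
    refine le_of_tendsto ht ?_
    filter_upwards [eventually_ge_atTop 0] with θ hθ
    refine le_iSup_of_le θ ?_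
    rw [EReal.coe_le_coe_iff]
    dsimp only
    rw [hL_of_le (by linarith)]
    have hfac : (2 * (d : ℝ) - 1) / (2 * d) * Real.exp θ + 1 / (2 * (d : ℝ)) * Real.exp (-θ) =
        Real.exp θ * ((2 * (d : ℝ) - 1) / (2 * d) + 1 / (2 * (d : ℝ)) * Real.exp (-θ) ^ 2) := by
      have : Real.exp θ * Real.exp (-θ) = 1 := by rw [← Real.exp_add]; simp
      linear_combination (-(1 / (2 * (d : ℝ))) * Real.exp (-θ)) * this
    rw [hfac, Real.log_mul (Real.exp_ne_zero _) (by positivity), Real.log_exp]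
    linarith

/-! ### Large deviations lower bound -/

lemma natCast_pow_self_eq_exp (m : ℕ) : (m : ℝ) ^ m = Real.exp (m * Real.log m) := by
  rcases m.eq_zero_or_pos with rfl | hm
  · simp
  · rw [Real.exp_nat_mul, Real.exp_log (by exact_mod_cast hm)]

lemma mul_negMulLog_div {n : ℝ} (hn : 0 < n) (a : ℝ) :
    n * Real.negMulLog (a / n) = a * Real.log n - a * Real.log a := by
  rcases eq_or_ne a 0 with rfl | ha
  · simp
  · rw [Real.negMulLog, Real.log_div ha hn.ne']
    field_simp
    ring

lemma liminf_log_div_ge_of_exp_le {u : ℕ → ENNReal} {r : ℕ → ℝ} {c : ℝ}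
    (hr : Tendsto r atTop (𝓝 c))
    (h : ∀ᶠ n : ℕ in atTop, ENNReal.ofReal (Real.exp (n * r n)) ≤ u n) :
    (c : EReal) ≤ liminf (fun n : ℕ => ENNReal.log (u n) / (n : EReal)) atTop := by
  rw [← ((continuous_coe_real_ereal.tendsto _).comp hr).liminf_eq]
  refine liminf_le_liminf ?_
  filter_upwards [h, eventually_gt_atTop 0] with n hn hn0
  refine le_trans (le_of_eq ?_) (EReal.div_le_div_right_of_nonneg (by positivity)
    (ENNReal.log_le_log hn))
  have hn' : (0 : ℝ) < n := by exact_mod_cast hn0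
  rw [ENNReal.log_ofReal_of_pos (Real.exp_pos _), Real.log_exp, ← EReal.coe_coe_eq_natCast,
    ← EReal.coe_div, Function.comp_apply, EReal.coe_eq_coe_iff]
  field_simp

section Walk

variable {d : ℕ} {Ω : Type*} [MeasurableSpace Ω] {μ : Measure Ω} [IsProbabilityMeasure μ]
  {ξ : ℕ → Ω → Fin d × Bool}

/-- The logarithmic correction pays for the polynomial factor through (n+1)² ≤ (2n)². -/
lemma exp_speedEntropy_le_measureReal (hd : 1 ≤ d) (hmeas : ∀ i, Measurable (ξ i))
    (hindep : iIndepFun ξ μ) (hunif : ∀ i a, μ (ξ i ⁻¹' {a}) = 1 / (2 * (d : ENNReal)))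
    {n b : ℕ} (hn : 0 < n) (hb : 2 * b ≤ n) :
    Real.exp (n * (speedEntropy d (1 - 2 * (b / n)) - 2 * (Real.log 2 / n + Real.log n / n))) ≤
      μ.real {ω | reducedLength (fun i => ξ i ω) n = n - 2 * b} := by
  have hn' : (0 : ℝ) < n := by exact_mod_cast hn
  have hd' : (1 : ℝ) ≤ d := by exact_mod_cast hd
  have hp : 0 < (2 * (d : ℝ) - 1) / (2 * d) := div_pos (by linarith) (by linarith)
  have hq : 0 < 1 / (2 * (d : ℝ)) := by positivity
  have h := pow_mul_pow_le_measureReal hd hmeas hindep hunif hb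
  have hab : ((n - b : ℕ) : ℝ) = n - b := Nat.cast_sub (by omega)
  have hexp : n * (speedEntropy d (1 - 2 * (b / n)) -
      2 * (Real.log 2 / n + Real.log n / n)) =
      n * Real.log n + (n - b : ℕ) * Real.log ((2 * d - 1) / (2 * d)) +
        b * Real.log (1 / (2 * d)) -
        (Real.log ((2 * n) ^ 2) + ((n - b : ℕ) * Real.log (n - b : ℕ) + b * Real.log b)) := by
    have e1 : (1 + (1 - 2 * ((b : ℝ) / n))) / 2 = (n - b : ℕ) / n := by
      rw [hab]; field_simp; ring
    have e2 : (1 - (1 - 2 * ((b : ℝ) / n))) / 2 = b / n := by ring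
    have l1 := mul_negMulLog_div hn' ((n - b : ℕ) : ℝ)
    have l2 := mul_negMulLog_div hn' (b : ℝ)
    rw [speedEntropy, e1, e2, Real.log_pow, Real.log_mul two_ne_zero hn'.ne', mul_sub, mul_add,
      mul_add, mul_add, l1, l2]
    rw [hab] at *
    field_simp
    push_cast
    ring
  rw [hexp, Real.exp_sub, div_le_iff₀ (Real.exp_pos _), Real.exp_add, Real.exp_add, Real.exp_add,
    Real.exp_add, ← natCast_pow_self_eq_exp, ← natCast_pow_self_eq_exp, ← natCast_pow_self_eq_exp,
    Real.exp_nat_mul, Real.exp_nat_mul, Real.exp_log hp, Real.exp_log hq,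
    Real.exp_log (by positivity), mul_comm (μ.real _)]
  refine h.trans ?_
  gcongr
  have : (1 : ℝ) ≤ n := by exact_mod_cast hn
  linarith

/-- With b = ⌊(1-x)n/2⌋ down steps the speed 1 - 2b/n tends to x, so the single event L_n = n - 2b
eventually lies in the target set and already has the right rate. -/
lemma speedEntropy_le_liminf (hd : 1 ≤ d) (hmeas : ∀ i, Measurable (ξ i))
    (hindep : iIndepFun ξ μ) (hunif : ∀ i a, μ (ξ i ⁻¹' {a}) = 1 / (2 * (d : ENNReal)))
    {Γ : Set ℝ} {x : ℝ} (hΓ : Γ ∈ 𝓝 x) (hx0 : 0 ≤ x) (hx1 : x ≤ 1) :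
    (speedEntropy d x : EReal) ≤ liminf (fun n : ℕ => ENNReal.log
      (μ {ω | (reducedLength (fun i => ξ i ω) n : ℝ) / n ∈ Γ}) / (n : EReal)) atTop := by
  have hβ : 0 ≤ (1 - x) / 2 := by linarith
  have hfloor : Tendsto (fun n : ℕ => (⌊(1 - x) / 2 * n⌋₊ : ℝ) / n) atTop (𝓝 ((1 - x) / 2)) :=
    (tendsto_nat_floor_mul_div_atTop hβ).comp tendsto_natCast_atTop_atTop
  have hspeed : Tendsto (fun n : ℕ => 1 - 2 * ((⌊(1 - x) / 2 * n⌋₊ : ℝ) / n)) atTop (𝓝 x) := by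
    have := (hfloor.const_mul 2).const_sub 1
    rwa [show 1 - 2 * ((1 - x) / 2) = x by ring] at this
  have hlog : Tendsto (fun n : ℕ => Real.log n / n) atTop (𝓝 0) :=
    Real.isLittleO_log_id_atTop.tendsto_div_nhds_zero.comp tendsto_natCast_atTop_atTop
  refine liminf_log_div_ge_of_exp_le (r := fun n : ℕ =>
    speedEntropy d (1 - 2 * ((⌊(1 - x) / 2 * n⌋₊ : ℝ) / n)) -
      2 * (Real.log 2 / n + Real.log n / n)) ?_ ?_
  · simpa using (((continuous_speedEntropy d).tendsto x).comp hspeed).sub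
      (((tendsto_const_div_atTop_nhds_zero_nat (Real.log 2)).add hlog).const_mul 2)
  · filter_upwards [hspeed.eventually hΓ, eventually_gt_atTop 0] with n hnΓ hn
    have hn' : (0 : ℝ) < n := by exact_mod_cast hn
    have hb : 2 * ⌊(1 - x) / 2 * n⌋₊ ≤ n := by
      have h1 : (⌊(1 - x) / 2 * n⌋₊ : ℝ) ≤ (1 - x) / 2 * n := Nat.floor_le (by positivity)
      have h2 : 0 ≤ x * n := by positivity
      have : (2 * ⌊(1 - x) / 2 * n⌋₊ : ℝ) ≤ n := by linarith
      exact_mod_cast this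
    refine (ENNReal.ofReal_le_ofReal
      (exp_speedEntropy_le_measureReal hd hmeas hindep hunif hn hb)).trans ?_
    rw [ofReal_measureReal]
    refine measure_mono fun ω (hω : _ = _) => ?_
    change (reducedLength (fun i => ξ i ω) n : ℝ) / n ∈ Γ
    rw [hω, Nat.cast_sub hb]
    have hmem : 1 - 2 * ((⌊(1 - x) / 2 * n⌋₊ : ℝ) / n) ∈ Γ := hnΓ
    convert hmem using 1
    push_cast
    field_simp

end Walk

lemma reducedLength_le {d : ℕ} (s : ℕ → Fin d × Bool) (n : ℕ) : reducedLength s n ≤ n := by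
  induction n with
  | zero => simp [reducedLength, freeGroupWalk]
  | succ n ih =>
    refine (FreeGroup.norm_mul_le _ _).trans (add_le_add ih ?_)
    exact FreeGroup.norm_mk_le

end

/-- The steps `ξ 0, ξ 1, …` are independent and uniform on the `2d` generators and inverses of
generators of the free group; `reducedLength` of them after `n` steps is `L_n`. -/
theorem corollary3p7 (d : ℕ) (hd : 1 ≤ d)
    {Ω : Type*} [MeasurableSpace Ω] (μ : Measure Ω) [IsProbabilityMeasure μ]
    (ξ : ℕ → Ω → Fin d × Bool)
    (hmeas : ∀ i, Measurable (ξ i))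
    (hindep : iIndepFun ξ μ)
    (hunif : ∀ i a, μ (ξ i ⁻¹' {a}) = 1 / (2 * (d : ENNReal))) :
    SatisfiesLDP
      (fun n : ℕ => μ.map (fun ω => (reducedLength (fun i => ξ i ω) n : ℝ) / (n : ℝ)))
      (legendreTransform (fun θ => Real.log (hL d θ))) := by
  have hmL (n : ℕ) : Measurable fun ω => (reducedLength (fun i => ξ i ω) n : ℝ) / (n : ℝ) :=
    (measurable_from_nat.comp (measurable_reducedLength hd hmeas n)).div_const _
  refine ⟨isRateFunction_legendreTransform (by simp [hL_zero hd]), fun Γ hΓ => ?_, fun Γ hΓ => ?_⟩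
  · rw [EReal.neg_le]
    refine le_iInf₂ fun x hx => ?_
    simp only [Measure.map_apply (hmL _) hΓ]
    rcases lt_or_ge x 0 with h0 | h0
    · simp [legendreTransform_log_hL_of_neg hd h0]
    rcases lt_or_ge 1 x with h1 | h1
    · simp [legendreTransform_log_hL_of_one_lt hd h1]
    refine le_trans ?_ (neg_speedEntropy_le_legendreTransform hd h0 h1)
    rw [EReal.neg_le, EReal.coe_neg, neg_neg]
    exact speedEntropy_le_liminf hd hmeas hindep hunif (mem_interior_iff_mem_nhds.1 hx) h0 h1
  · refine limsup_log_measure_le_of_lintegral_exp_le (isCompact_Icc (a := (0 : ℝ)) (b := 1))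
      (fun n => ?_) (fun θ => ?_) Γ
    · rw [Measure.map_apply (hmL n) measurableSet_Icc.compl]
      convert measure_empty (μ := μ)
      refine Set.eq_empty_of_forall_notMem fun ω hω => hω ⟨by positivity, ?_⟩
      exact div_le_one_of_le₀ (by exact_mod_cast reducedLength_le _ n) (Nat.cast_nonneg n)
    · obtain ⟨C, hC, h⟩ := exists_lintegral_exp_reducedLength_le hd hmeas hindep hunif θ
      refine ⟨C, hC, fun n => ?_⟩
      rw [lintegral_map (by fun_prop) (hmL n), Real.exp_nat_mul, Real.exp_log (hL_pos hd θ)]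
      refine le_trans (lintegral_mono fun ω => ENNReal.ofReal_le_ofReal (le_of_eq ?_)) (h n)
      -- At n = 0 the quotient is 0/0 = 0, and both exponents vanish since L_0 = 0.
      rcases n.eq_zero_or_pos with rfl | hn
      · simp [reducedLength, freeGroupWalk]
      · have : (n : ℝ) ≠ 0 := by positivity
        field_simp
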